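/- Let $p$ be a prime, $m,k\ge 1$ integers, $n=p^k$, and $\mathfrak R=\mathbb F_{p^m}[u]/\langle u^4\rangle$. Let $C$ be a cyclic code of length $n$ over $\mathfrak R$, i.e. an ideal of $\mathfrak R[x]/\langle x^n-1\rangle$; an element $\sum_{i=0}^{n-1}c_ix^i$ of $C$ is identified with the codeword $(c_0,\dots,c_{n-1})\in\mathfrak R^n$. The third torsion code of $C$ is $$Tor_3(C)=\{\mu(g)\in\mathbb F_{p^m}[x]/\langle x^n-1\rangle : g\in \mathfrak R[x]/\langle x^n-1\rangle,\ u^3g\in C\},$$ where $\mu$ is the projection reducing coefficients modulo $u$. There is a unique integer $0\le t_3\le n$, the third torsional degree of $C$, with $Tor_3(C)=\langle (x-1)^{t_3}\rangle$. The symbol-pair weight of $(c_0,\dots,c_{n-1})$ is the number of $i\in\{0,\dots,n-1\}$ with $(c_i,c_{i+1})\ne(0,0)$ (indices modulo $n$). Its Rosenbloom–Tsfasman (RT) weight is $1+\max\{i: c_i\neq 0\}$ if it is nonzero, and $0$ otherwise. Let $wt_{sp}(C)$ and $wt_{RT}(C)$ be the minimum of the respective weight over the nonzero codewords of $C$, both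 being $0$ by convention if $C=\{0\}$. Then: (i) $$wt_{sp}(C)=\begin{cases} 2 & \text{if } t_3=0,\\ 3p^\ell & \text{if } t_3=p^k-p^{k-\ell}+1,\ 0\le \ell\le k-2,\\ 4p^\ell & \text{if } p^k-p^{k-\ell}+2\le t_3\le p^k-p^{k-\ell}+p^{k-\ell-1},\ 0\le \ell\le k-2,\\ 2(\mu+2)p^\ell & \text{if } p^k-p^{k-\ell}+\mu p^{k-\ell-1}+1\le t_3\le p^k-p^{k-\ell}+(\mu+1)p^{k-\ell-1},\\ & \quad 0\le \ell\le k-2,\ 1\le\mu\le p-2,\\ (\mu+2)p^{k-1} & \text{if } t_3=p^k-p+\mu,\ 1\le\mu\le p-2,\\ p^k & \text{if } t_3=p^k-1,\\ 0 & \text{if } t_3=p^k. \end{cases}$$ (ii) $wt_{RT}(C)=t_3+1$ if $t_3<p^k$, and $wt_{RT}(C)=0$ if $t_3=p^k$ (that is, if $C=\{0\}$). -/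

import Mathlib

open Polynomial

noncomputable section

namespace CyclicCode

/-- The finite chain ring `F[u] / ⟨u ^ 4⟩`. -/
abbrev ChainRing (F : Type*) [Field F] : Type _ := AdjoinRoot (X ^ 4 : F[X])

/-- The element `u` of `F[u] / ⟨u ^ 4⟩`. -/
def u (F : Type*) [Field F] : ChainRing F := AdjoinRoot.root (X ^ 4 : F[X])

/-- The ring `A[x] / ⟨x ^ n - 1⟩`. Its ideals are the cyclic codes of length `n` over `A`. -/
abbrev CyclicRing (A : Type*) [CommRing A] (n : ℕ) : Type _ := AdjoinRoot (X ^ n - 1 : A[X])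

/-- The class of the variable `x` in `A[x] / ⟨x ^ n - 1⟩`. -/
def x (A : Type*) [CommRing A] (n : ℕ) : CyclicRing A n := AdjoinRoot.root (X ^ n - 1 : A[X])

/-- The residue map `F[u] / ⟨u ^ 4⟩ → F`, `u ↦ 0`. -/
def residue (F : Type*) [Field F] : ChainRing F →+* F :=
  AdjoinRoot.lift (RingHom.id F) 0 (by simp)

/-- The natural projection `(F[u] / ⟨u ^ 4⟩)[x] / ⟨x ^ n - 1⟩ → F[x] / ⟨x ^ n - 1⟩`: it reduces the
coefficients modulo `u` and sends `x` to `x`. -/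
def proj (F : Type*) [Field F] (n : ℕ) : CyclicRing (ChainRing F) n →+* CyclicRing F n :=
  AdjoinRoot.map (residue F) (X ^ n - 1) (X ^ n - 1) (by simp)

/-- The `i`-th torsion code of `C`: all projections of those `g` for which `u ^ i * g` lies
in `C`. -/
def torsionCode {F : Type*} [Field F] {n : ℕ} (i : ℕ) (C : Ideal (CyclicRing (ChainRing F) n)) :
    Set (CyclicRing F n) :=
  {f | ∃ g : CyclicRing (ChainRing F) n,
    AdjoinRoot.of (X ^ n - 1) (u F) ^ i * g ∈ C ∧ proj F n g = f}

/-- `t` is the `i`-th torsional degree of the cyclic code `C` of length `n`. -/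
def IsTorsionalDegree {F : Type*} [Field F] {n : ℕ} (i : ℕ)
    (C : Ideal (CyclicRing (ChainRing F) n)) (t : ℕ) : Prop :=
  t ≤ n ∧ torsionCode i C = (Ideal.span {(x F n - 1) ^ t} : Ideal (CyclicRing F n))

/-- The class of the polynomial `∑ i, c i * x ^ i` in `A[x] / ⟨x ^ n - 1⟩`. -/
def ofVector {A : Type*} [CommRing A] {n : ℕ} (c : Fin n → A) : CyclicRing A n :=
  ∑ i : Fin n, AdjoinRoot.of (X ^ n - 1) (c i) * x A n ^ (i : ℕ)

/-- The codewords of a cyclic code, as vectors of length `n`: the coefficient vectors of its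
elements with respect to `1, x, …, x ^ (n - 1)`. -/
def codewords {A : Type*} [CommRing A] {n : ℕ} (C : Ideal (CyclicRing A n)) : Set (Fin n → A) :=
  {c | ofVector c ∈ C}

/-- The cyclic successor `i ↦ i + 1 mod n`. -/
def next {n : ℕ} (i : Fin n) : Fin n := ⟨(i + 1) % n, Nat.mod_lt _ i.pos⟩

/-- The symbol-pair weight: the number of `i` with `(c i, c (i + 1)) ≠ (0, 0)`, indices mod `n`. -/
def pairWeight {A : Type*} [Zero A] {n : ℕ} (c : Fin n → A) : ℕ :=
  Set.ncard {i : Fin n | (c i, c (next i)) ≠ (0, 0)}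

open Classical in
/-- The Rosenbloom–Tsfasman weight: the maximum of `1 + i` over all `i` with `c i ≠ 0`, and `0` for
the zero vector. -/
def rtWeight {A : Type*} [Zero A] {n : ℕ} (c : Fin n → A) : ℕ :=
  (Finset.univ.filter fun i : Fin n => c i ≠ 0).sup fun i => 1 + (i : ℕ)

/-- The minimum weight of a cyclic code with respect to a weight function: the minimum over the
nonzero codewords; it is `0` for the zero code. -/
def minWeight {A : Type*} [CommRing A] {n : ℕ} (wt : (Fin n → A) → ℕ)
    (C : Ideal (CyclicRing A n)) : ℕ :=
  sInf {w | ∃ c ∈ codewords C, c ≠ 0 ∧ wt c = w}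

end CyclicCode

end

/-! Multiplying a nonzero codeword by the last power of `u` that does not kill it gives a word `u ^
3 * d` of `C`, with `d` a nonzero word over `F` in the third torsion code whose support lies inside
that of the codeword. Conversely each `d` in the torsion code gives `u ^ 3 * d` in `C` with the same
support. Both weights depend only on the support and grow with it, so the minima for `C` are those
over nonzero polynomials of degree `< p ^ k` divisible by `(X - 1) ^ t`. For the RT weight the
minimum is attained by `(X - 1) ^ t` itself.

For the pair weight, `(X - 1) ^ (p ^ k - p ^ K)` is the sum of the powers `X ^ (p ^ K * j)`, so its
multiples are words of length `p ^ K` repeated `p ^ (k - K)` times (`IsMinWeight.repeat`). This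
leaves small `t` at length `p ^ K`.

There the main tool is `lt_card_support_of_X_sub_one_pow_dvd`: if the exponents of a nonzero `f` are
distinct modulo `p`, divisibility by `(X - 1) ^ t` forces more than `t` terms. In general the word
is split by residues of the exponents modulo `q = p ^ (K - 1)`: each class that occurs has many
terms, and either there is only one class and no two terms are adjacent, or the pairs meet at least
three classes (`two_mul_le_cyclicPairWeight`). Powers of `X ^ q - 1` attain the bounds. -/

noncomputable section

namespace CyclicCode

/-! ### Coefficient vectors as polynomials of degree below `n` -/

section Vectors

variable {A : Type*} [CommRing A] {n : ℕ}

open Classical in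
/-- The polynomial `∑ i, c i X ^ i`. -/
def toPoly (c : Fin n → A) : A[X] := ofFn n c

lemma toPoly_coeff (c : Fin n → A) {i : ℕ} (hi : i < n) : (toPoly c).coeff i = c ⟨i, hi⟩ := by
  simp [toPoly, hi]

open Classical in
lemma toPoly_degree_lt (c : Fin n → A) : (toPoly c).degree < n := ofFn_degree_lt c

open Classical in
lemma toPoly_injective : Function.Injective (toPoly : (Fin n → A) → A[X]) := injective_ofFn n

lemma toPoly_eq_zero {c : Fin n → A} : toPoly c = 0 ↔ c = 0 :=
  ⟨fun h => toPoly_injective (h.trans (by simp [toPoly])), fun h => by simp [h, toPoly]⟩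

lemma exists_toPoly_eq {f : A[X]} (hf : f.degree < n) : ∃ c : Fin n → A, toPoly c = f := by
  refine ⟨fun i => f.coeff i, ?_⟩
  ext i
  by_cases hi : i < n
  · simp [toPoly_coeff, hi]
  · rw [coeff_eq_zero_of_degree_lt (hf.trans_le (by exact_mod_cast not_lt.1 hi)),
      coeff_eq_zero_of_degree_lt ((toPoly_degree_lt _).trans_le (by exact_mod_cast not_lt.1 hi))]

lemma ofVector_eq_mk (c : Fin n → A) : ofVector c = AdjoinRoot.mk (X ^ n - 1) (toPoly c) := by
  simp [ofVector, toPoly, ofFn_eq_sum_monomial, ← C_mul_X_pow_eq_monomial, x]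

lemma monic_X_pow_sub_one (hn : n ≠ 0) : (X ^ n - 1 : A[X]).Monic := by
  simpa using monic_X_pow_sub_C (1 : A) hn

lemma degree_X_pow_sub_one [Nontrivial A] (hn : n ≠ 0) : (X ^ n - 1 : A[X]).degree = n := by
  simpa using degree_X_pow_sub_C (Nat.pos_of_ne_zero hn) (1 : A)

lemma ofVector_surjective [Nontrivial A] (hn : n ≠ 0) :
    Function.Surjective (ofVector : (Fin n → A) → CyclicRing A n) := by
  intro y
  obtain ⟨f, rfl⟩ := AdjoinRoot.mk_surjective y
  have hm := monic_X_pow_sub_one (A := A) hn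
  have hd := degree_modByMonic_lt f hm
  rw [degree_X_pow_sub_one hn] at hd
  obtain ⟨c, hc⟩ := exists_toPoly_eq hd
  refine ⟨c, ?_⟩
  rw [ofVector_eq_mk, hc, AdjoinRoot.mk_eq_mk, modByMonic_eq_sub_mul_div]
  exact ⟨-(f /ₘ (X ^ n - 1)), by ring⟩

lemma ofVector_eq_zero [Nontrivial A] (hn : n ≠ 0) {c : Fin n → A} (h : ofVector c = 0) :
    c = 0 := by
  by_contra hc
  rw [ofVector_eq_mk, AdjoinRoot.mk_eq_zero] at h
  refine (monic_X_pow_sub_one (A := A) hn).not_dvd_of_degree_lt (mt toPoly_eq_zero.1 hc) ?_ h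
  rw [degree_X_pow_sub_one hn]
  exact toPoly_degree_lt c

lemma of_mul_ofVector (a : A) (c : Fin n → A) :
    AdjoinRoot.of (X ^ n - 1) a * ofVector c = ofVector (fun i => a * c i) := by
  simp [ofVector, Finset.mul_sum, mul_assoc]

end Vectors

/-! ### Codewords of `C` against words of the torsion code -/

section ChainRing

variable {F : Type*} [Field F] {n : ℕ}

instance : Nontrivial (ChainRing F) :=
  AdjoinRoot.nontrivial _ (by simp)

lemma u_pow_mul_eq_zero_iff (P : F[X]) (j : ℕ) :
    u F ^ j * AdjoinRoot.mk (X ^ 4) P = 0 ↔ X ^ 4 ∣ X ^ j * P := by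
  rw [← AdjoinRoot.mk_eq_zero, map_mul, map_pow, AdjoinRoot.mk_X, u]

lemma residue_mk (P : F[X]) : residue F (AdjoinRoot.mk (X ^ 4) P) = P.coeff 0 := by
  rw [residue, AdjoinRoot.lift_mk, coeff_zero_eq_eval_zero]
  rfl

lemma u_pow_four : u F ^ 4 = 0 := by
  have := (u_pow_mul_eq_zero_iff (1 : F[X]) 4).2 (by simp)
  simpa using this

lemma u_pow_three_mul_eq_zero {a : ChainRing F} : u F ^ 3 * a = 0 ↔ residue F a = 0 := by
  obtain ⟨P, rfl⟩ := AdjoinRoot.mk_surjective a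
  rw [residue_mk, u_pow_mul_eq_zero_iff, ← X_dvd_iff, show (X : F[X]) ^ 4 = X ^ 3 * X by ring]
  exact mul_dvd_mul_iff_left (pow_ne_zero _ X_ne_zero)

lemma exists_eq_of_u_mul_eq_zero {a : ChainRing F} (h : u F * a = 0) :
    ∃ b : F, a = u F ^ 3 * AdjoinRoot.of (X ^ 4) b := by
  obtain ⟨P, rfl⟩ := AdjoinRoot.mk_surjective a
  have h' : X ^ 3 ∣ P := by
    have := (u_pow_mul_eq_zero_iff P 1).1 (by simpa using h)
    rw [show (X : F[X]) ^ 4 = X ^ 1 * X ^ 3 by ring] at this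
    exact (mul_dvd_mul_iff_left (pow_ne_zero _ X_ne_zero)).1 this
  obtain ⟨Q, rfl⟩ := h'
  refine ⟨Q.coeff 0, ?_⟩
  rw [map_mul, map_pow, AdjoinRoot.mk_X, ← u, ← sub_eq_zero, ← mul_sub, u_pow_three_mul_eq_zero,
    ← AdjoinRoot.mk_C, ← map_sub, residue_mk]
  simp

lemma residue_of (b : F) : residue F (AdjoinRoot.of (X ^ 4) b) = b := by
  rw [← AdjoinRoot.mk_C, residue_mk, coeff_C_zero]

/-- With `j + 1` the least exponent killing every entry, the entries of `u ^ j * c` are annihilated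
by `u`, hence lie in the socle `u ^ 3 F`, and they are not all zero. -/
lemma exists_u_pow_mul {ι : Type*} {c : ι → ChainRing F} (hc : c ≠ 0) :
    ∃ j, ∃ d : ι → F, d ≠ 0 ∧ ∀ i, u F ^ j * c i = u F ^ 3 * AdjoinRoot.of (X ^ 4) (d i) := by
  classical
  have h4 : ∃ j, ∀ i, u F ^ j * c i = 0 := ⟨4, fun i => by rw [u_pow_four, zero_mul]⟩
  have hs := Nat.find_spec h4
  have h0 : Nat.find h4 ≠ 0 := fun h => hc (funext fun i => by
    have := hs i
    rwa [h, pow_zero, one_mul] at this)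
  obtain ⟨j, hj⟩ := Nat.exists_eq_succ_of_ne_zero h0
  have hmin := Nat.find_min h4 (m := j) (by omega)
  have : ∀ i, ∃ b : F, u F ^ j * c i = u F ^ 3 * AdjoinRoot.of (X ^ 4) b := fun i =>
    exists_eq_of_u_mul_eq_zero (by
      have := hs i
      rwa [hj, Nat.succ_eq_add_one, pow_succ' (u F) j, mul_assoc] at this)
  choose d hd using this
  refine ⟨j, d, ?_, hd⟩
  rintro rfl
  exact hmin fun i => by simp [hd]

lemma proj_ofVector (c : Fin n → ChainRing F) :
    proj F n (ofVector c) = ofVector (fun i => residue F (c i)) := by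
  simp [ofVector, proj, x]

lemma proj_ofVector_of (d : Fin n → F) :
    proj F n (ofVector fun i => AdjoinRoot.of (X ^ 4) (d i)) = ofVector d := by
  simp [proj_ofVector, residue_of]

lemma proj_surjective (hn : n ≠ 0) : Function.Surjective (proj F n) := by
  intro y
  obtain ⟨d, rfl⟩ := ofVector_surjective hn y
  exact ⟨_, proj_ofVector_of d⟩

/-- Makes the choice of lift `g` in the definition of the torsion code immaterial, so that it can be
taken with coefficients in `F`. -/
lemma u_pow_three_mul_eq_of_proj_eq (hn : n ≠ 0) {g g' : CyclicRing (ChainRing F) n}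
    (h : proj F n g = proj F n g') :
    AdjoinRoot.of (X ^ n - 1) (u F) ^ 3 * g = AdjoinRoot.of (X ^ n - 1) (u F) ^ 3 * g' := by
  rw [← sub_eq_zero, ← mul_sub]
  rw [← sub_eq_zero, ← map_sub] at h
  obtain ⟨c, hc⟩ := ofVector_surjective hn (g - g')
  rw [← hc, proj_ofVector] at h
  have h' := ofVector_eq_zero hn h
  rw [← hc, ← map_pow, of_mul_ofVector]
  have : (fun i => u F ^ 3 * c i) = 0 :=
    funext fun i => u_pow_three_mul_eq_zero.2 (congrFun h' i)
  rw [this]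
  simp [ofVector]

/-- The `i`-th torsion code as an ideal. -/
def torsionIdeal (i : ℕ) (C : Ideal (CyclicRing (ChainRing F) n)) : Ideal (CyclicRing F n) :=
  Ideal.map (proj F n) (Submodule.comap
    (LinearMap.mulLeft (CyclicRing (ChainRing F) n) (AdjoinRoot.of (X ^ n - 1) (u F) ^ i)) C)

lemma coe_torsionIdeal (hn : n ≠ 0) (i : ℕ) (C : Ideal (CyclicRing (ChainRing F) n)) :
    (torsionIdeal i C : Set (CyclicRing F n)) = torsionCode i C := by
  ext y
  rw [SetLike.mem_coe, torsionIdeal, Ideal.mem_map_iff_of_surjective _ (proj_surjective hn)]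
  rfl

lemma exists_mem_codewords_torsion {C : Ideal (CyclicRing (ChainRing F) n)}
    {c : Fin n → ChainRing F} (hc : c ∈ codewords C) (h0 : c ≠ 0) :
    ∃ d : Fin n → F, ofVector d ∈ torsionCode 3 C ∧ d ≠ 0 ∧ ∀ i, d i ≠ 0 → c i ≠ 0 := by
  obtain ⟨j, d, hd, h⟩ := exists_u_pow_mul h0
  refine ⟨d, ⟨ofVector fun i => AdjoinRoot.of (X ^ 4) (d i), ?_, proj_ofVector_of d⟩, hd, ?_⟩
  · have := C.mul_mem_left (AdjoinRoot.of (X ^ n - 1) (u F ^ j)) hc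
    rw [of_mul_ofVector] at this
    rw [← map_pow, of_mul_ofVector]
    simpa only [h] using this
  · intro i hi hci
    have := h i
    rw [hci, mul_zero, eq_comm, u_pow_three_mul_eq_zero, residue_of] at this
    exact hi this

lemma exists_mem_codewords_of_torsion (hn : n ≠ 0) {C : Ideal (CyclicRing (ChainRing F) n)}
    {d : Fin n → F} (hd : ofVector d ∈ torsionCode 3 C) :
    ∃ c ∈ codewords C, ∀ i, c i ≠ 0 ↔ d i ≠ 0 := by
  obtain ⟨g, hg, hgd⟩ := hd
  rw [← proj_ofVector_of] at hgd
  rw [u_pow_three_mul_eq_of_proj_eq hn hgd, ← map_pow, of_mul_ofVector] at hg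
  refine ⟨_, hg, fun i => ?_⟩
  rw [not_iff_not, u_pow_three_mul_eq_zero, residue_of]

end ChainRing

/-! ### The ideals of `F[x] / ⟨x ^ (p ^ k) - 1⟩` are generated by powers of `x - 1` -/

section Torsion

variable {F : Type*} [Field F] {p k : ℕ} [Fact p.Prime] [CharP F p]

lemma X_pow_prime_pow_sub_one (k : ℕ) : (X ^ p ^ k - 1 : F[X]) = (X - 1) ^ p ^ k := by
  rw [sub_pow_char_pow, one_pow]

lemma mk_mem_span_iff {t : ℕ} (ht : t ≤ p ^ k) (f : F[X]) :
    AdjoinRoot.mk (X ^ p ^ k - 1) f ∈ Ideal.span {(x F (p ^ k) - 1) ^ t} ↔ (X - 1) ^ t ∣ f := by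
  have hx : (x F (p ^ k) - 1) ^ t = AdjoinRoot.mk (X ^ p ^ k - 1) ((X - 1) ^ t) := by simp [x]
  rw [hx, Ideal.mem_span_singleton]
  refine ⟨fun ⟨g, hg⟩ => ?_, map_dvd _⟩
  obtain ⟨g, rfl⟩ := AdjoinRoot.mk_surjective g
  rw [← map_mul, AdjoinRoot.mk_eq_mk, X_pow_prime_pow_sub_one] at hg
  -- The modulus is `(X - 1) ^ p ^ k`, itself a multiple of `(X - 1) ^ t` because `t ≤ p ^ k`.
  exact (dvd_sub_left (dvd_mul_right _ _)).1 ((pow_dvd_pow _ ht).trans hg)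

/-- The preimage in the principal ideal domain `F[X]` contains `(X - 1) ^ p ^ k`, so its generator
is associated to a power of the prime `X - 1`. -/
lemma exists_eq_span (I : Ideal (CyclicRing F (p ^ k))) :
    ∃ t ≤ p ^ k, I = Ideal.span {(x F (p ^ k) - 1) ^ t} := by
  obtain ⟨d, hd⟩ := (IsPrincipalIdealRing.principal
    (I.comap (AdjoinRoot.mk (X ^ p ^ k - 1)))).principal
  rw [Ideal.submodule_span_eq] at hd
  have hmem : (X ^ p ^ k - 1 : F[X]) ∈ I.comap (AdjoinRoot.mk (X ^ p ^ k - 1)) := by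
    rw [Ideal.mem_comap, AdjoinRoot.mk_self]
    exact I.zero_mem
  rw [hd, Ideal.mem_span_singleton, X_pow_prime_pow_sub_one] at hmem
  have hX : Prime (X - 1 : F[X]) := by simpa using prime_X_sub_C (1 : F)
  obtain ⟨t, ht, hdt⟩ := (dvd_prime_pow hX _).1 hmem
  refine ⟨t, ht, ?_⟩
  ext y
  obtain ⟨f, rfl⟩ := AdjoinRoot.mk_surjective y
  rw [mk_mem_span_iff ht, ← hdt.dvd_iff_dvd_left, ← Ideal.mem_span_singleton, ← hd,
    Ideal.mem_comap]

lemma existsUnique_isTorsionalDegree (i : ℕ) (C : Ideal (CyclicRing (ChainRing F) (p ^ k))) :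
    ∃! t : ℕ, IsTorsionalDegree i C t := by
  have hn : p ^ k ≠ 0 := pow_ne_zero _ (Fact.out : p.Prime).ne_zero
  obtain ⟨t, ht, h⟩ := exists_eq_span (torsionIdeal i C)
  have key : ∀ {s t : ℕ}, IsTorsionalDegree i C s → IsTorsionalDegree i C t → s ≤ t := by
    rintro s t ⟨hs, hs'⟩ ⟨ht, ht'⟩
    have h : AdjoinRoot.mk (X ^ p ^ k - 1) ((X - 1) ^ t) ∈
        Ideal.span {(x F (p ^ k) - 1) ^ s} := by
      rw [← SetLike.mem_coe, ← hs', ht', SetLike.mem_coe, mk_mem_span_iff ht]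
    rw [mk_mem_span_iff hs] at h
    have hX : Prime (X - 1 : F[X]) := by simpa using prime_X_sub_C (1 : F)
    exact (pow_dvd_pow_iff hX.ne_zero hX.not_isUnit).1 h
  have h₀ : IsTorsionalDegree i C t := ⟨ht, by rw [← coe_torsionIdeal hn, h]⟩
  exact ⟨t, h₀, fun s hs => le_antisymm (key hs h₀) (key h₀ hs)⟩

lemma ofVector_mem_torsionCode_iff {i t : ℕ} {C : Ideal (CyclicRing (ChainRing F) (p ^ k))}
    (h : IsTorsionalDegree i C t) (d : Fin (p ^ k) → F) :
    ofVector d ∈ torsionCode i C ↔ (X - 1) ^ t ∣ toPoly d := by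
  rw [h.2, SetLike.mem_coe, ofVector_eq_mk, mk_mem_span_iff h.1]

end Torsion

/-! ### The two weights in terms of polynomials -/

section Weights

variable {A : Type*} [CommRing A] {n : ℕ}

open Classical in
/-- The symbol-pair weight of the coefficient vector of `f`, taken with indices modulo `n`. -/
def cyclicPairWeight (n : ℕ) (f : A[X]) : ℕ :=
  Nat.count (fun i => f.coeff (i % n) ≠ 0 ∨ f.coeff ((i + 1) % n) ≠ 0) n

open Classical in
/-- The support of the coefficient vector of `f` as a subset of `ZMod n`. -/
def cyclicSupport (n : ℕ) [NeZero n] (f : A[X]) : Finset (ZMod n) :=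
  Finset.univ.filter fun i => f.coeff i.val ≠ 0

lemma mem_cyclicSupport [NeZero n] {f : A[X]} {i : ZMod n} :
    i ∈ cyclicSupport n f ↔ f.coeff i.val ≠ 0 := by
  simp [cyclicSupport]

/-- The union of `S` and its translate by `-1`. -/
def withPred {G : Type*} [AddGroupWithOne G] [DecidableEq G] (S : Finset G) : Finset G :=
  S ∪ S.image (· - 1)

lemma mem_withPred {G : Type*} [AddGroupWithOne G] [DecidableEq G] {S : Finset G} {i : G} :
    i ∈ withPred S ↔ i ∈ S ∨ i + 1 ∈ S := by
  simp [withPred, sub_eq_iff_eq_add]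

lemma cyclicPairWeight_eq_card [NeZero n] (f : A[X]) :
    cyclicPairWeight n f = (withPred (cyclicSupport n f)).card := by
  classical
  rw [cyclicPairWeight, Nat.count_eq_card_filter_range]
  refine Finset.card_bij (fun i _ => (i : ZMod n)) ?_ ?_ ?_
  · intro i hi
    rw [Finset.mem_filter] at hi
    rw [mem_withPred, mem_cyclicSupport, mem_cyclicSupport, ← Nat.cast_succ, ZMod.val_natCast,
      ZMod.val_natCast]
    exact hi.2
  · intro i hi j hj hij
    simp only [Finset.mem_filter, Finset.mem_range] at hi hj
    have := congrArg ZMod.val hij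
    rwa [ZMod.val_natCast, ZMod.val_natCast, Nat.mod_eq_of_lt hi.1, Nat.mod_eq_of_lt hj.1] at this
  · intro i hi
    refine ⟨i.val, ?_, ZMod.natCast_zmod_val i⟩
    rw [mem_withPred, mem_cyclicSupport, mem_cyclicSupport] at hi
    rw [Finset.mem_filter, Finset.mem_range, ← ZMod.val_natCast, ← ZMod.val_natCast, Nat.cast_succ,
      ZMod.natCast_zmod_val]
    exact ⟨ZMod.val_lt i, hi⟩

lemma pairWeight_eq_cyclicPairWeight (c : Fin n → A) :
    pairWeight c = cyclicPairWeight n (toPoly c) := by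
  classical
  rw [cyclicPairWeight, Nat.count_eq_card_filter_range, pairWeight,
    ← Set.ncard_image_of_injective _ Fin.val_injective, ← Set.ncard_coe_finset]
  congr 1
  ext i
  simp only [Set.mem_image, Set.mem_ofPred_eq, Finset.coe_filter, Finset.mem_range, ne_eq,
    Prod.mk.injEq, not_and_or]
  constructor
  · rintro ⟨j, hj, rfl⟩
    refine ⟨j.2, ?_⟩
    rwa [Nat.mod_eq_of_lt j.2, toPoly_coeff c j.2, toPoly_coeff c (Nat.mod_lt _ j.pos)]
  · rintro ⟨hi, h⟩
    refine ⟨⟨i, hi⟩, ?_, rfl⟩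
    rwa [Nat.mod_eq_of_lt hi, toPoly_coeff c hi,
      toPoly_coeff c (Nat.mod_lt _ (Nat.zero_lt_of_lt hi))] at h

lemma rtWeight_eq_natDegree (c : Fin n → A) (hc : c ≠ 0) :
    rtWeight c = (toPoly c).natDegree + 1 := by
  classical
  have h0 : toPoly c ≠ 0 := mt toPoly_eq_zero.1 hc
  have hd : (toPoly c).natDegree < n := (natDegree_lt_iff_degree_lt h0).2 (toPoly_degree_lt c)
  refine le_antisymm (Finset.sup_le fun i hi => ?_) ?_
  · rw [add_comm]
    refine Nat.add_le_add_right (le_natDegree_of_ne_zero ?_) 1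
    rw [toPoly_coeff c i.2]
    exact (Finset.mem_filter.1 hi).2
  · rw [add_comm]
    refine Finset.le_sup (f := fun i : Fin n => 1 + (i : ℕ)) (b := ⟨_, hd⟩) ?_
    rw [Finset.mem_filter, ← toPoly_coeff c hd]
    exact ⟨Finset.mem_univ _, leadingCoeff_ne_zero.2 h0⟩

variable {B : Type*} [CommRing B]

lemma pairWeight_mono {c : Fin n → A} {d : Fin n → B} (h : ∀ i, c i ≠ 0 → d i ≠ 0) :
    pairWeight c ≤ pairWeight d := by
  refine Set.ncard_le_ncard (fun i hi => ?_) (Set.toFinite _)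
  simp only [Set.mem_ofPred_eq, ne_eq, Prod.mk.injEq, not_and_or] at hi ⊢
  exact hi.imp (h _) (h _)

lemma rtWeight_mono {c : Fin n → A} {d : Fin n → B} (h : ∀ i, c i ≠ 0 → d i ≠ 0) :
    rtWeight c ≤ rtWeight d := by
  refine Finset.sup_mono fun i hi => ?_
  simp only [Finset.mem_filter, Finset.mem_univ, true_and] at hi ⊢
  exact h i hi

end Weights

/-! ### Transfer of minimum weights to multiples of `(X - 1) ^ t` -/

section MinWeight

variable {F : Type*} [Field F] {p k : ℕ} [Fact p.Prime] [CharP F p]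

/-- `w` is the minimum of the weight `wt` over the nonzero polynomials of degree less than `n` that
are divisible by `(X - 1) ^ t`. -/
def IsMinWeight (wt : F[X] → ℕ) (n t w : ℕ) : Prop :=
  (∀ f : F[X], f ≠ 0 → f.degree < n → (X - 1) ^ t ∣ f → w ≤ wt f) ∧
    ∃ f : F[X], f ≠ 0 ∧ f.degree < n ∧ (X - 1) ^ t ∣ f ∧ wt f ≤ w

/-- `hle` and `hge` express that the weight is monotone in the support, across the two alphabets. -/
lemma minWeight_eq_of_isMinWeight {C : Ideal (CyclicRing (ChainRing F) (p ^ k))} {t w : ℕ}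
    (ht : IsTorsionalDegree 3 C t) {wtR : (Fin (p ^ k) → ChainRing F) → ℕ}
    {wtF : (Fin (p ^ k) → F) → ℕ} {wt : F[X] → ℕ}
    (hle : ∀ c d, (∀ i, d i ≠ 0 → c i ≠ 0) → wtF d ≤ wtR c)
    (hge : ∀ c d, (∀ i, c i ≠ 0 → d i ≠ 0) → wtR c ≤ wtF d)
    (hwt : ∀ d, d ≠ 0 → wtF d = wt (toPoly d)) (hw : IsMinWeight wt (p ^ k) t w) :
    minWeight wtR C = w := by
  have hn : p ^ k ≠ 0 := pow_ne_zero _ (Fact.out : p.Prime).ne_zero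
  have hlow : ∀ c ∈ codewords C, c ≠ 0 → w ≤ wtR c := by
    intro c hc h0
    obtain ⟨d, hd, hd0, hdc⟩ := exists_mem_codewords_torsion hc h0
    rw [ofVector_mem_torsionCode_iff ht] at hd
    refine le_trans ?_ (hle c d hdc)
    rw [hwt d hd0]
    exact hw.1 _ (mt toPoly_eq_zero.1 hd0) (by exact_mod_cast toPoly_degree_lt d) hd
  obtain ⟨f, hf0, hfd, hft, hfw⟩ := hw.2
  obtain ⟨d, rfl⟩ := exists_toPoly_eq hfd
  obtain ⟨c, hc, hcd⟩ :=
    exists_mem_codewords_of_torsion hn ((ofVector_mem_torsionCode_iff ht d).2 hft)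
  have hd0 : d ≠ 0 := mt toPoly_eq_zero.2 hf0
  have hc0 : c ≠ 0 := by
    obtain ⟨i, hi⟩ := Function.ne_iff.1 hd0
    exact Function.ne_iff.2 ⟨i, (hcd i).2 hi⟩
  have hcw : wtR c ≤ w := (hge c d fun i => (hcd i).1).trans ((hwt d hd0).trans_le hfw)
  have hmem : wtR c ∈ {w | ∃ c ∈ codewords C, c ≠ 0 ∧ wtR c = w} := ⟨c, hc, hc0, rfl⟩
  refine le_antisymm ((Nat.sInf_le hmem).trans hcw) (le_csInf ⟨_, hmem⟩ ?_)
  rintro _ ⟨c', hc', hc0', rfl⟩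
  exact hlow c' hc' hc0'

lemma minWeight_pairWeight_eq {C : Ideal (CyclicRing (ChainRing F) (p ^ k))} {t w : ℕ}
    (ht : IsTorsionalDegree 3 C t)
    (hw : IsMinWeight (cyclicPairWeight (A := F) (p ^ k)) (p ^ k) t w) :
    minWeight pairWeight C = w :=
  minWeight_eq_of_isMinWeight ht (fun _ _ => pairWeight_mono) (fun _ _ => pairWeight_mono)
    (fun d _ => pairWeight_eq_cyclicPairWeight d) hw

lemma minWeight_rtWeight_eq {C : Ideal (CyclicRing (ChainRing F) (p ^ k))} {t w : ℕ}
    (ht : IsTorsionalDegree 3 C t)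
    (hw : IsMinWeight (fun f : F[X] => f.natDegree + 1) (p ^ k) t w) :
    minWeight rtWeight C = w :=
  minWeight_eq_of_isMinWeight ht (fun _ _ => rtWeight_mono) (fun _ _ => rtWeight_mono)
    (fun d hd => rtWeight_eq_natDegree d hd) hw

lemma natDegree_X_sub_one_pow (t : ℕ) : ((X - 1 : F[X]) ^ t).natDegree = t := by
  have : (X - 1 : F[X]).natDegree = 1 := by simpa using natDegree_X_sub_C (1 : F)
  rw [natDegree_pow, this, mul_one]

lemma X_sub_one_pow_ne_zero (t : ℕ) : (X - 1 : F[X]) ^ t ≠ 0 :=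
  pow_ne_zero _ (by simpa using X_sub_C_ne_zero (1 : F))

lemma degree_X_sub_one_pow (t : ℕ) : ((X - 1 : F[X]) ^ t).degree = t := by
  rw [degree_eq_natDegree (X_sub_one_pow_ne_zero t), natDegree_X_sub_one_pow]

lemma isMinWeight_natDegree {n t : ℕ} (ht : t < n) :
    IsMinWeight (fun f : F[X] => f.natDegree + 1) n t (t + 1) := by
  refine ⟨fun f hf _ h => ?_, (X - 1) ^ t, X_sub_one_pow_ne_zero t, ?_, dvd_rfl, ?_⟩
  · have := natDegree_le_of_dvd h hf
    rw [natDegree_X_sub_one_pow] at this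
    exact Nat.add_le_add_right this 1
  · rw [degree_X_sub_one_pow]
    exact_mod_cast ht
  · simp only [natDegree_X_sub_one_pow, le_refl]

lemma minWeight_eq_zero {C : Ideal (CyclicRing (ChainRing F) (p ^ k))}
    (ht : IsTorsionalDegree 3 C (p ^ k)) (wt : (Fin (p ^ k) → ChainRing F) → ℕ) :
    minWeight wt C = 0 := by
  -- There are no nonzero codewords, and `sInf ∅ = 0` in `ℕ`.
  refine Nat.sInf_eq_zero.2 (Or.inr (Set.eq_empty_of_forall_notMem ?_))
  rintro _ ⟨c, hc, h0, rfl⟩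
  obtain ⟨d, hd, hd0, -⟩ := exists_mem_codewords_torsion hc h0
  rw [ofVector_mem_torsionCode_iff ht] at hd
  have h := degree_le_of_dvd hd (mt toPoly_eq_zero.1 hd0)
  rw [degree_X_sub_one_pow] at h
  exact absurd (toPoly_degree_lt d) (not_lt.2 h)

end MinWeight

/-! ### A subset of a cyclic group joined with its translate by `-1` -/

section Translates

/-- A nonempty set closed under predecessors is all of `ZMod n`; otherwise some predecessor is new.
-/
lemma le_card_withPred {n : ℕ} [NeZero n] {S : Finset (ZMod n)} (hS : S.Nonempty) :
    min (S.card + 1) n ≤ (withPred S).card := by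
  by_cases h : ∀ i, i + 1 ∈ S → i ∈ S
  · obtain ⟨s, hs⟩ := hS
    have hall : ∀ j : ℕ, s - j ∈ S := by
      intro j
      induction j with
      | zero => simpa using hs
      | succ j ih => exact h _ (by rwa [Nat.cast_succ, ← sub_sub, sub_add_cancel])
    have huniv : S = Finset.univ := Finset.eq_univ_of_forall fun i => by
      have := hall (s - i).val
      rwa [ZMod.natCast_zmod_val, sub_sub_cancel] at this
    refine (min_le_right _ _).trans ?_
    calc n = S.card := by rw [huniv, Finset.card_univ, ZMod.card]
      _ ≤ _ := Finset.card_le_card Finset.subset_union_left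
  · push Not at h
    obtain ⟨i, hi, hi'⟩ := h
    refine (min_le_left _ _).trans ?_
    rw [← Finset.card_insert_of_notMem hi']
    refine Finset.card_le_card (Finset.insert_subset ?_ Finset.subset_union_left)
    exact mem_withPred.2 (Or.inr hi)

variable {G H : Type*} [Ring G] [Ring H] [DecidableEq G]

lemma card_image_sub_one (S : Finset G) : (S.image (· - 1)).card = S.card :=
  Finset.card_image_of_injective _ (sub_left_injective)

lemma card_withPred_le (S : Finset G) : (withPred S).card ≤ 2 * S.card := by
  refine (Finset.card_union_le _ _).trans ?_
  rw [card_image_sub_one, two_mul]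

/-- Elements with the same image under `φ` cannot differ by `1`, so `S` and its translate are
disjoint. -/
lemma card_withPred_of_image_subset [Nontrivial H] {φ : G →+* H} {S : Finset G} {r : H}
    (h : ∀ i ∈ S, φ i = r) : (withPred S).card = 2 * S.card := by
  rw [withPred, Finset.card_union_of_disjoint, card_image_sub_one, two_mul]
  rw [Finset.disjoint_left]
  intro i hi hi'
  obtain ⟨j, hj, rfl⟩ := Finset.mem_image.1 hi'
  have := h _ hi
  rw [map_sub, h j hj, map_one, sub_eq_self] at this
  exact one_ne_zero this

/-- Over a point `r` of the image lies a fibre of `S`; if instead `r + 1` is in the image, the fibre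
over it shifted by `-1` lies over `r`. -/
lemma mul_card_withPred_image_le [DecidableEq H] {φ : G →+* H} {S : Finset G} {m : ℕ}
    (h : ∀ i ∈ S, m ≤ (S.filter fun j => φ j = φ i).card) :
    m * (withPred (S.image φ)).card ≤ (withPred S).card := by
  have hmaps : ∀ i ∈ withPred S, φ i ∈ withPred (S.image φ) := by
    intro i hi
    rw [mem_withPred] at hi ⊢
    refine hi.imp (Finset.mem_image_of_mem φ) fun hi => ?_
    simpa using Finset.mem_image_of_mem φ hi
  rw [Finset.card_eq_sum_card_fiberwise hmaps, mul_comm, ← smul_eq_mul]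
  refine Finset.card_nsmul_le_sum _ _ _ fun r hr => ?_
  rcases mem_withPred.1 hr with hr | hr
  · obtain ⟨i, hi, rfl⟩ := Finset.mem_image.1 hr
    exact (h i hi).trans (Finset.card_le_card
      (Finset.filter_subset_filter _ Finset.subset_union_left))
  · obtain ⟨i, hi, hir⟩ := Finset.mem_image.1 hr
    refine (h i hi).trans ?_
    rw [← card_image_sub_one]
    refine Finset.card_le_card fun j hj => ?_
    obtain ⟨l, hl, rfl⟩ := Finset.mem_image.1 hj
    rw [Finset.mem_filter] at hl ⊢
    refine ⟨mem_withPred.2 (Or.inr (by simpa using hl.1)), ?_⟩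
    rw [map_sub, hl.2, hir, map_one, add_sub_cancel_right]

end Translates

/-! ### Elementary bounds on the pair weight -/

section Weights

variable {A : Type*} [CommRing A] {n : ℕ}

lemma cyclicPairWeight_le (f : A[X]) : cyclicPairWeight n f ≤ n := by
  classical exact Nat.count_le _

lemma card_cyclicSupport_le [NeZero n] (f : A[X]) :
    (cyclicSupport n f).card ≤ f.support.card :=
  Finset.card_le_card_of_injOn ZMod.val
    (fun _ hi => mem_support_iff.2 (mem_cyclicSupport.1 hi)) (ZMod.val_injective n).injOn

lemma card_cyclicSupport [NeZero n] {f : A[X]} (hf : f.degree < n) :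
    (cyclicSupport n f).card = f.support.card := by
  refine le_antisymm (card_cyclicSupport_le f) ?_
  have hlt : ∀ i ∈ f.support, i < n := fun i hi => by
    exact_mod_cast (le_degree_of_mem_supp i hi).trans_lt hf
  refine Finset.card_le_card_of_injOn (fun i : ℕ => (i : ZMod n)) (fun i hi => ?_) ?_
  · rw [Finset.mem_coe, mem_cyclicSupport, ZMod.val_natCast, Nat.mod_eq_of_lt (hlt i hi)]
    exact mem_support_iff.1 hi
  · intro i hi j hj hij
    have := congrArg ZMod.val hij
    simpa only [ZMod.val_natCast, Nat.mod_eq_of_lt (hlt i hi), Nat.mod_eq_of_lt (hlt j hj)]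
      using this

lemma cyclicSupport_nonempty [NeZero n] {f : A[X]} (h0 : f ≠ 0) (hf : f.degree < n) :
    (cyclicSupport n f).Nonempty := by
  rw [← Finset.card_pos, card_cyclicSupport hf, Finset.card_pos, support_nonempty]
  exact h0

lemma min_le_cyclicPairWeight {f : A[X]} (h0 : f ≠ 0) (hf : f.degree < n) :
    min (f.support.card + 1) n ≤ cyclicPairWeight n f := by
  rcases eq_or_ne n 0 with rfl | hn
  · simp
  have : NeZero n := ⟨hn⟩
  rw [cyclicPairWeight_eq_card, ← card_cyclicSupport hf]
  exact le_card_withPred (cyclicSupport_nonempty h0 hf)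

lemma cyclicPairWeight_le_two_mul (f : A[X]) :
    cyclicPairWeight n f ≤ 2 * f.support.card := by
  rcases eq_or_ne n 0 with rfl | hn
  · simp [cyclicPairWeight]
  have : NeZero n := ⟨hn⟩
  rw [cyclicPairWeight_eq_card]
  exact (card_withPred_le _).trans (Nat.mul_le_mul_left 2 (card_cyclicSupport_le f))

lemma cyclicPairWeight_le_natDegree_add_two (f : A[X]) :
    cyclicPairWeight n f ≤ f.natDegree + 2 := by
  rcases eq_or_ne n 0 with rfl | hn
  · simp [cyclicPairWeight]
  have : NeZero n := ⟨hn⟩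
  rw [cyclicPairWeight_eq_card]
  -- The indices that count lie among `-1, 0, …, natDegree f`.
  have hsub : withPred (cyclicSupport n f) ⊆
      (Finset.range (f.natDegree + 2)).image fun i : ℕ => (i : ZMod n) - 1 := by
    intro i hi
    rw [mem_withPred, mem_cyclicSupport, mem_cyclicSupport] at hi
    rw [Finset.mem_image]
    rcases hi with hi | hi
    · refine ⟨i.val + 1, ?_, by simp⟩
      have := le_natDegree_of_ne_zero hi
      rw [Finset.mem_range]
      omega
    · refine ⟨(i + 1).val, ?_, by simp⟩
      have := le_natDegree_of_ne_zero hi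
      rw [Finset.mem_range]
      omega
  exact (Finset.card_le_card hsub).trans (Finset.card_image_le.trans (Finset.card_range _).le)

lemma cyclicPairWeight_of_repeat {M N : ℕ} (hN : N ≠ 0) {f g : A[X]}
    (h : ∀ i < M * N, f.coeff i = g.coeff (i % N)) :
    cyclicPairWeight (M * N) f = M * cyclicPairWeight N g := by
  classical
  rcases Nat.eq_zero_or_pos M with rfl | hM
  · simp [cyclicPairWeight]
  have hMN : 0 < M * N := Nat.mul_pos hM (Nat.pos_of_ne_zero hN)
  have hcoeff : ∀ i, f.coeff (i % (M * N)) = g.coeff (i % N) := fun i => by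
    rw [h _ (Nat.mod_lt _ hMN), Nat.mod_mul_left_mod]
  simp only [cyclicPairWeight, hcoeff]
  clear h hcoeff hMN hM
  induction M with
  | zero => simp
  | succ M ih =>
    rw [Nat.succ_mul, Nat.count_add, ih, Nat.succ_mul]
    simp only [add_assoc, Nat.mul_comm M N, Nat.mul_add_mod]

end Weights

/-! ### Number of terms against the multiplicity of the root `1` -/

section Bounds

variable {F : Type*} [Field F]

lemma X_sub_one_dvd_iff {f : F[X]} : X - 1 ∣ f ↔ f.eval 1 = 0 := by
  rw [← C_1, dvd_iff_isRoot, IsRoot.def]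

/-- Induction on `t`: for an exponent `i` of `f`, the operator `X * d/dX - i` multiplies the
coefficient at `j` by `j - i`. It removes exactly the term at `i`, since the exponents are distinct
in `F`, and costs one factor `X - 1`. -/
lemma lt_card_support_of_X_sub_one_pow_dvd {t : ℕ} {f : F[X]} (hf : f ≠ 0)
    (hinj : Set.InjOn (Nat.cast : ℕ → F) f.support) (h : (X - 1) ^ t ∣ f) :
    t < f.support.card := by
  induction t generalizing f with
  | zero => exact Finset.card_pos.2 (support_nonempty.2 hf)
  | succ t ih =>
    obtain ⟨i, hi⟩ := support_nonempty.2 hf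
    set g : F[X] := X * derivative f - C (i : F) * f with hg
    have hcoeff : ∀ j, g.coeff j = ((j : F) - i) * f.coeff j := by
      intro j
      rw [hg, coeff_sub, coeff_C_mul]
      cases j with
      | zero => simp
      | succ j =>
        rw [coeff_X_mul, coeff_derivative]
        push_cast
        ring
    have hsupp : g.support = f.support.erase i := by
      ext j
      rw [Finset.mem_erase, mem_support_iff, hcoeff, mul_ne_zero_iff, sub_ne_zero,
        ← mem_support_iff]
      refine and_congr_left fun hj => ?_
      exact (hinj.ne_iff hj hi)
    have hdvd : (X - 1) ^ t ∣ g := by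
      refine dvd_sub (dvd_mul_of_dvd_right ?_ _) (dvd_mul_of_dvd_right ?_ _)
      · simpa using pow_sub_one_dvd_derivative_of_pow_dvd h
      · exact (pow_dvd_pow _ t.le_succ).trans h
    have hg0 : g ≠ 0 := by
      intro hg0
      rw [hg0, support_zero, eq_comm, Finset.erase_eq_empty_iff] at hsupp
      rcases hsupp with hs | hs
      · exact hf (support_eq_empty.1 hs)
      -- Here `f` is a nonzero monomial, which does not vanish at `1`.
      · obtain ⟨k, a, ha, hfa⟩ := card_support_eq_one.1 (by rw [hs, Finset.card_singleton])
        have h1 := X_sub_one_dvd_iff.1 ((dvd_pow_self _ t.succ_ne_zero).trans h)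
        simp [hfa, ha] at h1
    have := ih hg0 (hinj.mono (by rw [hsupp]; exact_mod_cast Finset.erase_subset _ _)) hdvd
    rw [hsupp, Finset.card_erase_of_mem hi] at this
    omega

end Bounds

/-! ### Repeated words -/

section Repeat

variable {F : Type*} [Field F]

lemma coeff_mul_sum_X_pow {M N i : ℕ} (hi : i < M * N) {g : F[X]} (hg : g.degree < N) :
    (g * ∑ j ∈ Finset.range M, X ^ (N * j)).coeff i = g.coeff (i % N) := by
  have hN : 0 < N := Nat.pos_of_ne_zero (by rintro rfl; simp at hi)
  rw [Finset.mul_sum, finsetSum_coeff]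
  simp only [coeff_mul_X_pow']
  rw [Finset.sum_eq_single (i / N)]
  · rw [if_pos (Nat.mul_div_le i N), Nat.mod_eq_sub_mul_div]
  · intro j _ hj
    split_ifs with h
    · refine coeff_eq_zero_of_degree_lt (hg.trans_le ?_)
      have h1 : j ≤ i / N := (Nat.le_div_iff_mul_le hN).2 (by rwa [mul_comm])
      have h2 : N * (j + 1) ≤ i :=
        (Nat.mul_le_mul_left N (Nat.succ_le_of_lt (lt_of_le_of_ne h1 hj))).trans
          (Nat.mul_div_le i N)
      rw [Nat.mul_succ] at h2
      exact_mod_cast (show N ≤ i - N * j by omega)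
    · rfl
  · intro h
    exact absurd (Finset.mem_range.2 (Nat.div_lt_of_lt_mul (by rwa [mul_comm]))) h

variable {p : ℕ} [Fact p.Prime] [CharP F p]

/-- After multiplication by `(X - 1) ^ p ^ K = X ^ p ^ K - 1` this is a geometric sum. -/
lemma X_sub_one_pow_eq_sum (l K : ℕ) :
    (X - 1 : F[X]) ^ (p ^ l * p ^ K - p ^ K) = ∑ j ∈ Finset.range (p ^ l), X ^ (p ^ K * j) := by
  have hp : 0 < p := (Fact.out : p.Prime).pos
  have hle : p ^ K ≤ p ^ l * p ^ K := Nat.le_mul_of_pos_left _ (pow_pos hp _)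
  refine mul_right_cancel₀ (X_sub_one_pow_ne_zero (F := F) (p ^ K)) ?_
  rw [← pow_add, Nat.sub_add_cancel hle, ← pow_add, ← X_pow_prime_pow_sub_one, pow_add,
    ← X_pow_prime_pow_sub_one]
  simp only [pow_mul]
  rw [geom_sum_mul, pow_right_comm]

/-- Multiplication by `(X - 1) ^ (p ^ l * p ^ K - p ^ K)` writes a word of length `p ^ K` out `p ^
l` times, so its cyclic pair weight is multiplied by `p ^ l`. -/
lemma IsMinWeight.repeat {K s w : ℕ}
    (h : IsMinWeight (cyclicPairWeight (A := F) (p ^ K)) (p ^ K) s w) (l : ℕ) :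
    IsMinWeight (cyclicPairWeight (A := F) (p ^ l * p ^ K)) (p ^ l * p ^ K)
      (p ^ l * p ^ K - p ^ K + s) (p ^ l * w) := by
  have hp : 0 < p := (Fact.out : p.Prime).pos
  have hle : p ^ K ≤ p ^ l * p ^ K := Nat.le_mul_of_pos_left _ (pow_pos hp _)
  have hdeg : ∀ g : F[X], g ≠ 0 →
      ((g * (X - 1) ^ (p ^ l * p ^ K - p ^ K)).degree < ((p ^ l * p ^ K : ℕ) : WithBot ℕ) ↔
        g.degree < ((p ^ K : ℕ) : WithBot ℕ)) := by
    intro g hg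
    rw [← natDegree_lt_iff_degree_lt (mul_ne_zero hg (X_sub_one_pow_ne_zero _)),
      ← natDegree_lt_iff_degree_lt hg, natDegree_mul hg (X_sub_one_pow_ne_zero _),
      natDegree_X_sub_one_pow]
    omega
  have hpw : ∀ g : F[X], g.degree < ((p ^ K : ℕ) : WithBot ℕ) →
      cyclicPairWeight (p ^ l * p ^ K) (g * (X - 1) ^ (p ^ l * p ^ K - p ^ K)) =
        p ^ l * cyclicPairWeight (p ^ K) g := by
    intro g hg
    refine cyclicPairWeight_of_repeat (pow_pos hp K).ne' fun i hi => ?_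
    rw [X_sub_one_pow_eq_sum, coeff_mul_sum_X_pow hi hg]
  refine ⟨fun f hf hfd hdvd => ?_, ?_⟩
  · obtain ⟨g, rfl⟩ := hdvd
    rw [pow_add, mul_assoc, mul_comm ((X - 1) ^ (p ^ l * p ^ K - p ^ K))] at hf hfd ⊢
    have hg := left_ne_zero_of_mul hf
    rw [hdeg _ hg] at hfd
    rw [hpw _ hfd]
    exact Nat.mul_le_mul_left _ (h.1 _ hg hfd (dvd_mul_right _ _))
  · obtain ⟨g, hg, hgd, hgs, hgw⟩ := h.2
    refine ⟨g * (X - 1) ^ (p ^ l * p ^ K - p ^ K),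
      mul_ne_zero hg (X_sub_one_pow_ne_zero _), (hdeg g hg).2 hgd, ?_, ?_⟩
    · rw [pow_add, mul_comm]
      exact mul_dvd_mul_right hgs _
    · rw [hpw g hgd]
      exact Nat.mul_le_mul_left _ hgw

end Repeat

/-! ### Exponents `0` and `1`, and length `p` -/

section SmallDegree

variable {F : Type*} [Field F] {p : ℕ} [Fact p.Prime] [CharP F p]

omit [Fact p.Prime] in
lemma injOn_natCast_Ico (a : ℕ) : Set.InjOn (Nat.cast : ℕ → F) (Set.Ico a (a + p)) := by
  intro i hi j hj hij
  rw [CharP.natCast_eq_natCast F p] at hij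
  exact Nat.ModEq.eq_of_abs_lt hij (by
    rw [abs_lt]
    obtain ⟨_, _⟩ := hi
    obtain ⟨_, _⟩ := hj
    constructor <;> omega)

lemma isMinWeight_zero {n : ℕ} (hn : 2 ≤ n) :
    IsMinWeight (cyclicPairWeight (A := F) n) n 0 2 := by
  refine ⟨fun f hf hd _ => ?_, 1, one_ne_zero, ?_, by simp, ?_⟩
  · have := min_le_cyclicPairWeight hf hd
    have := Finset.card_pos.2 (support_nonempty.2 hf)
    omega
  · rw [degree_one]
    exact_mod_cast (by omega : 0 < n)
  · simpa using cyclicPairWeight_le_natDegree_add_two (n := n) (1 : F[X])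

lemma isMinWeight_one {n : ℕ} (hn : 3 ≤ n) :
    IsMinWeight (cyclicPairWeight (A := F) n) n 1 3 := by
  refine ⟨fun f hf hd hdvd => ?_, (X - 1) ^ 1, X_sub_one_pow_ne_zero 1, ?_, dvd_rfl, ?_⟩
  · have h1 := min_le_cyclicPairWeight hf hd
    have h2 : 1 < f.support.card := by
      by_contra hle
      refine hle (lt_card_support_of_X_sub_one_pow_dvd hf ?_ hdvd)
      exact Set.Subsingleton.injOn
        (fun i hi j hj => Finset.card_le_one.1 (not_lt.1 hle) i hi j hj) _
    omega
  · rw [degree_X_sub_one_pow]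
    exact_mod_cast (by omega : 1 < n)
  · refine (cyclicPairWeight_le_natDegree_add_two _).trans ?_
    rw [natDegree_X_sub_one_pow]

omit [Fact p.Prime] in
lemma isMinWeight_prime {t : ℕ} (ht : t < p) :
    IsMinWeight (cyclicPairWeight (A := F) p) p t (min (t + 2) p) := by
  refine ⟨fun f hf hd hdvd => ?_, (X - 1) ^ t, X_sub_one_pow_ne_zero t, ?_, dvd_rfl, ?_⟩
  · have h1 := min_le_cyclicPairWeight hf hd
    have hsub : (f.support : Set ℕ) ⊆ Set.Ico 0 (0 + p) := fun i hi => by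
      rw [zero_add]
      exact ⟨i.zero_le, by exact_mod_cast (le_degree_of_mem_supp i hi).trans_lt hd⟩
    have h2 := lt_card_support_of_X_sub_one_pow_dvd hf ((injOn_natCast_Ico 0).mono hsub) hdvd
    omega
  · rw [degree_X_sub_one_pow]
    exact_mod_cast ht
  · refine le_min ((cyclicPairWeight_le_natDegree_add_two _).trans ?_) (cyclicPairWeight_le _)
    rw [natDegree_X_sub_one_pow]

end SmallDegree

/-! ### Words from powers of `X ^ p ^ j - 1`, and the value `4` -/

section Classes

variable {F : Type*} [Field F] {p : ℕ} [Fact p.Prime] [CharP F p]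

lemma X_sub_one_pow_mul (j m : ℕ) :
    (X - 1 : F[X]) ^ (m * p ^ j) = expand F (p ^ j) ((X - 1) ^ m) := by
  rw [map_pow, map_sub, map_one, expand_X, X_pow_prime_pow_sub_one, ← pow_mul, mul_comm]

omit [Fact p.Prime] [CharP F p] in
lemma card_support_expand_le {q : ℕ} (hq : 0 < q) (g : F[X]) :
    (expand F q g).support.card ≤ g.support.card := by
  refine le_trans (Finset.card_le_card (t := g.support.image (· * q)) fun i hi => ?_)
    Finset.card_image_le
  rw [mem_support_iff, coeff_expand hq] at hi
  split_ifs at hi with h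
  · exact Finset.mem_image.2 ⟨i / q, mem_support_iff.2 hi, Nat.div_mul_cancel h⟩
  · exact absurd rfl hi

/-- By Frobenius `(X - 1) ^ (m * p ^ j) = (X ^ p ^ j - 1) ^ m`, which has at most `m + 1` terms,
each in two pairs. -/
lemma exists_word_of_mul {j m : ℕ} (hm : m < p) :
    ∃ f : F[X], f ≠ 0 ∧ f.degree < (p ^ (j + 1) : ℕ) ∧ (X - 1) ^ (m * p ^ j) ∣ f ∧
      cyclicPairWeight (p ^ (j + 1)) f ≤ 2 * (m + 1) := by
  have hp : 0 < p := (Fact.out : p.Prime).pos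
  refine ⟨(X - 1) ^ (m * p ^ j), X_sub_one_pow_ne_zero _, ?_, dvd_rfl, ?_⟩
  · rw [degree_X_sub_one_pow, pow_succ']
    exact_mod_cast Nat.mul_lt_mul_of_pos_right hm (pow_pos hp j)
  · refine (cyclicPairWeight_le_two_mul _).trans (Nat.mul_le_mul_left 2 ?_)
    rw [X_sub_one_pow_mul]
    refine (card_support_expand_le (pow_pos hp j) _).trans ?_
    refine (card_supp_le_succ_natDegree _).trans ?_
    rw [natDegree_X_sub_one_pow]

lemma isMinWeight_four {j t : ℕ} (hj : 1 ≤ j) (ht : 2 ≤ t) (ht' : t ≤ p ^ j) :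
    IsMinWeight (cyclicPairWeight (A := F) (p ^ (j + 1))) (p ^ (j + 1)) t 4 := by
  have hp : p.Prime := Fact.out
  have : NeZero p := ⟨hp.ne_zero⟩
  refine ⟨fun f hf hd hdvd => ?_, ?_⟩
  · have hn : 4 ≤ p ^ (j + 1) := by
      calc 4 = 2 ^ (1 + 1) := rfl
        _ ≤ p ^ (1 + 1) := Nat.pow_le_pow_left hp.two_le _
        _ ≤ _ := Nat.pow_le_pow_right hp.pos (by omega)
    have h1 := min_le_cyclicPairWeight hf hd
    by_cases hinj : Set.InjOn (Nat.cast : ℕ → F) f.support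
    · have := lt_card_support_of_X_sub_one_pow_dvd hf hinj hdvd
      omega
    · by_cases hcard : 3 ≤ f.support.card
      · omega
      -- What remains is a word with two terms whose exponents agree modulo `p`; they are not
      -- cyclically adjacent, so they meet four pairs.
      · simp only [Set.InjOn, not_forall] at hinj
        obtain ⟨a, ha, b, hb, hab, hne⟩ := hinj
        have hsub : f.support = {a, b} := by
          symm
          refine Finset.eq_of_subset_of_card_le ?_ ?_
          · rw [Finset.insert_subset_iff, Finset.singleton_subset_iff]
            exact ⟨ha, hb⟩
          · rw [Finset.card_pair hne]
            omega
        rw [CharP.natCast_eq_natCast F p] at hab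
        have := nontrivial_of_ne (0 : ZMod p) 1 (by
          have := Fact.mk hp.one_lt
          exact zero_ne_one)
        have hφ : ∀ i ∈ cyclicSupport (p ^ (j + 1)) f,
            ZMod.castHom (dvd_pow_self p j.succ_ne_zero) (ZMod p) i = (a : ZMod p) := by
          intro i hi
          have hi' : i.val ∈ f.support := mem_support_iff.2 (mem_cyclicSupport.1 hi)
          rw [hsub, Finset.mem_insert, Finset.mem_singleton] at hi'
          rw [← ZMod.natCast_zmod_val i, map_natCast]
          rcases hi' with h | h
          · rw [h]
          · rw [h, ZMod.natCast_eq_natCast_iff]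
            exact hab.symm
        rw [cyclicPairWeight_eq_card, card_withPred_of_image_subset hφ, card_cyclicSupport hd,
          hsub, Finset.card_pair hne]
  · obtain ⟨f, hf, hd, hdvd, hw⟩ := exists_word_of_mul (F := F) (p := p) (j := j) hp.one_lt
    refine ⟨f, hf, hd, (pow_dvd_pow _ ?_).trans hdvd, hw⟩
    rwa [one_mul]

end Classes

/-! ### Splitting a word by residues of exponents modulo `q` -/

section ResidueClasses

variable {F : Type*} [Field F] {q n : ℕ}

/-- The polynomial `∑ m, a m X ^ (m + 1)`, where `a m` is the coefficient of `f` at `m q + r`, for `r < q`. -/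
def classPoly (q r : ℕ) (f : F[X]) : F[X] := contract q (X ^ (q - r) * f)

lemma coeff_classPoly (hq : q ≠ 0) (r : ℕ) (f : F[X]) (m : ℕ) :
    (classPoly q r f).coeff m = if q - r ≤ m * q then f.coeff (m * q - (q - r)) else 0 := by
  rw [classPoly, coeff_contract hq, coeff_X_pow_mul']

lemma mem_support_classPoly (hq : q ≠ 0) {r m : ℕ} {f : F[X]} :
    m ∈ (classPoly q r f).support ↔ q - r ≤ m * q ∧ m * q - (q - r) ∈ f.support := by
  rw [mem_support_iff, coeff_classPoly hq, mem_support_iff]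
  split_ifs with h <;> simp [h]

lemma lt_of_mem_support {f : F[X]} (hf : f.degree < n) {i : ℕ} (hi : i ∈ f.support) : i < n := by
  exact_mod_cast (le_degree_of_mem_supp i hi).trans_lt hf

lemma card_support_classPoly_le [NeZero q] [NeZero n] (hqn : q ∣ n) {f : F[X]}
    (hf : f.degree < n) (r : ZMod q) :
    (classPoly q r.val f).support.card ≤
      ((cyclicSupport n f).filter fun i => ZMod.castHom hqn (ZMod q) i = r).card := by
  have hq : q ≠ 0 := NeZero.ne q
  have hr := ZMod.val_lt r
  refine Finset.card_le_card_of_injOn (fun m => ((m * q - (q - r.val) : ℕ) : ZMod n)) ?_ ?_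
  · intro m hm
    rw [Finset.mem_coe, mem_support_classPoly hq] at hm
    rw [Finset.mem_coe, Finset.mem_filter, mem_cyclicSupport, ZMod.val_natCast,
      Nat.mod_eq_of_lt (lt_of_mem_support hf hm.2), map_natCast, Nat.cast_sub hm.1,
      Nat.cast_sub hr.le]
    exact ⟨mem_support_iff.1 hm.2, by simp⟩
  · intro m hm m' hm' h
    rw [Finset.mem_coe, mem_support_classPoly hq] at hm hm'
    have h' := congrArg ZMod.val h
    simp only [ZMod.val_natCast, Nat.mod_eq_of_lt (lt_of_mem_support hf hm.2),
      Nat.mod_eq_of_lt (lt_of_mem_support hf hm'.2)] at h'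
    have : m * q = m' * q := by
      have := hm.1
      have := hm'.1
      omega
    exact Nat.eq_of_mul_eq_mul_right (Nat.pos_of_ne_zero hq) this

/-- The exponents fill a window of `p` consecutive integers, on which the cast to `F` is injective;
this makes the bound on the number of terms applicable to each class. -/
lemma support_classPoly_subset {p r : ℕ} (hr : r < q) {f : F[X]} (hf : f.degree < (q * p : ℕ)) :
    ((classPoly q r f).support : Set ℕ) ⊆ Set.Ico 1 (1 + p) := by
  intro m hm
  have hq : q ≠ 0 := by omega
  rw [Finset.mem_coe, mem_support_classPoly hq] at hm
  have h1 := hm.1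
  have h2 := lt_of_mem_support hf hm.2
  constructor
  · by_contra h
    obtain rfl : m = 0 := by omega
    omega
  · have : q * m < q * (1 + p) := by
      rw [Nat.mul_add, Nat.mul_one, Nat.mul_comm q m]
      omega
    exact lt_of_mul_lt_mul_left this (Nat.zero_le q)

lemma exists_eq_mul_sub {i r : ℕ} (hr : r < q) (hi : i % q = r) :
    q - r ≤ (i / q + 1) * q ∧ (i / q + 1) * q - (q - r) = i := by
  have h := Nat.div_add_mod i q
  rw [hi] at h
  rw [Nat.add_mul, Nat.one_mul, Nat.mul_comm]
  omega

lemma val_castHom [NeZero n] (hqn : q ∣ n) (i : ZMod n) :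
    (ZMod.castHom hqn (ZMod q) i).val = i.val % q := by
  rw [← ZMod.val_natCast, ← map_natCast (ZMod.castHom hqn (ZMod q)), ZMod.natCast_zmod_val]

lemma classPoly_ne_zero [NeZero q] [NeZero n] (hqn : q ∣ n) {f : F[X]} {i : ZMod n}
    (hi : i ∈ cyclicSupport n f) : classPoly q (ZMod.castHom hqn (ZMod q) i).val f ≠ 0 := by
  have hr := ZMod.val_lt (ZMod.castHom hqn (ZMod q) i)
  obtain ⟨h1, h2⟩ := exists_eq_mul_sub hr (val_castHom hqn i).symm
  rw [← support_nonempty]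
  refine ⟨i.val / q + 1, (mem_support_classPoly (NeZero.ne q)).2 ⟨h1, ?_⟩⟩
  rw [h2]
  exact mem_support_iff.2 (mem_cyclicSupport.1 hi)

lemma expand_classPoly [NeZero q] [NeZero n] (hqn : q ∣ n) {f : F[X]} (hf : f.degree < n)
    {r : ZMod q} (h : ∀ i ∈ cyclicSupport n f, ZMod.castHom hqn (ZMod q) i = r) :
    expand F q (classPoly q r.val f) = X ^ (q - r.val) * f := by
  have hr := ZMod.val_lt r
  ext i
  rw [coeff_expand (NeZero.pos q), classPoly, coeff_contract (NeZero.ne q)]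
  split_ifs with hqi
  · rw [Nat.div_mul_cancel hqi]
  · rw [coeff_X_pow_mul']
    split_ifs with hle
    · by_contra hne
      have hsupp : i - (q - r.val) ∈ f.support := mem_support_iff.2 (Ne.symm hne)
      have hlt := lt_of_mem_support hf hsupp
      have hcast := h ((i - (q - r.val) : ℕ) : ZMod n) (by
        rw [mem_cyclicSupport, ZMod.val_natCast, Nat.mod_eq_of_lt hlt]
        exact mem_support_iff.1 hsupp)
      rw [map_natCast, Nat.cast_sub hle, Nat.cast_sub hr.le] at hcast
      simp only [CharP.cast_eq_zero, ZMod.natCast_val, ZMod.cast_id', id_eq, zero_sub, sub_neg_eq_add,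
        add_eq_right] at hcast
      exact hqi ((ZMod.natCast_eq_zero_iff _ _).1 hcast)
    · rfl

variable {p : ℕ} [Fact p.Prime] [CharP F p]

/-- The power is the expansion of `(X - 1) ^ m`, and contraction pulls expanded factors out. -/
lemma X_sub_one_pow_dvd_classPoly {j m : ℕ} {f : F[X]} (h : (X - 1) ^ (m * p ^ j) ∣ f) (r : ℕ) :
    (X - 1) ^ m ∣ classPoly (p ^ j) r f := by
  obtain ⟨g, rfl⟩ := h
  rw [classPoly, X_sub_one_pow_mul, mul_left_comm, mul_comm,
    contract_mul_expand (pow_ne_zero _ (Fact.out : p.Prime).ne_zero)]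
  exact dvd_mul_left _ _

/-- After cancelling `(X - 1) ^ (m * p ^ j)`, the remaining factor `X - 1` only tests the value at
`1`, which expansion preserves. -/
lemma X_sub_one_pow_succ_dvd_of_expand {j m : ℕ} {g : F[X]}
    (h : (X - 1) ^ (m * p ^ j + 1) ∣ expand F (p ^ j) g) (hg : (X - 1) ^ m ∣ g) :
    (X - 1) ^ (m + 1) ∣ g := by
  obtain ⟨g, rfl⟩ := hg
  rw [map_mul, ← X_sub_one_pow_mul, pow_succ,
    mul_dvd_mul_iff_left (X_sub_one_pow_ne_zero _), X_sub_one_dvd_iff, expand_eval, one_pow,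
    ← X_sub_one_dvd_iff] at h
  rw [pow_succ]
  exact mul_dvd_mul_left _ h

/-- Each class that occurs has at least `m + 1` terms. If there is only one, the extra factor `X -
1` gives it `m + 2` terms, no two adjacent. -/
lemma two_mul_le_cyclicPairWeight {j m : ℕ} (hq : 3 ≤ p ^ j) (hm : 1 ≤ m)
    {f : F[X]} (hf : f ≠ 0) (hd : f.degree < (p ^ j * p : ℕ)) (h : (X - 1) ^ (m * p ^ j + 1) ∣ f) :
    2 * (m + 2) ≤ cyclicPairWeight (p ^ j * p) f := by
  have : NeZero p := ⟨(Fact.out : p.Prime).ne_zero⟩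
  have hqn : p ^ j ∣ p ^ j * p := dvd_mul_right _ _
  have : Fact (1 < p ^ j) := ⟨by omega⟩
  set φ := ZMod.castHom hqn (ZMod (p ^ j))
  set S := cyclicSupport (p ^ j * p) f
  have hS : S.Nonempty := cyclicSupport_nonempty hf hd
  have hclass : ∀ (i : ZMod (p ^ j * p)) (t : ℕ), i ∈ S →
      (X - 1) ^ t ∣ classPoly (p ^ j) (φ i).val f → t < (S.filter fun l => φ l = φ i).card := by
    intro i t hi ht
    refine lt_of_lt_of_le ?_ (card_support_classPoly_le hqn hd _)
    exact lt_card_support_of_X_sub_one_pow_dvd (classPoly_ne_zero hqn hi)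
      ((injOn_natCast_Ico 1).mono (support_classPoly_subset (ZMod.val_lt _) hd)) ht
  have hdvd := X_sub_one_pow_dvd_classPoly ((pow_dvd_pow _ (Nat.le_succ _)).trans h)
  rw [cyclicPairWeight_eq_card]
  by_cases hR : (S.image φ).card ≤ 1
  · obtain ⟨i, hi⟩ := hS
    have hall : ∀ l ∈ S, φ l = φ i := fun l hl =>
      Finset.card_le_one.1 hR _ (Finset.mem_image_of_mem φ hl) _ (Finset.mem_image_of_mem φ hi)
    have hexp := expand_classPoly hqn hd hall
    have h1 := hclass i (m + 1) hi (X_sub_one_pow_succ_dvd_of_expand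
      (by rw [hexp]; exact dvd_mul_of_dvd_right h _) (hdvd _))
    rw [card_withPred_of_image_subset hall]
    have := Finset.card_filter_le S fun l => φ l = φ i
    omega
  · have h1 := mul_card_withPred_image_le (φ := φ) (m := m + 1) fun i hi => hclass i m hi (hdvd _)
    have h2 := le_card_withPred (hS.image φ)
    -- Two classes and their predecessors make at least three residues, as `3 ≤ p ^ j`; and `3 * (m
    -- + 1) ≥ 2 * (m + 2)` because `1 ≤ m`.
    have h3 : (m + 1) * 3 ≤ (m + 1) * (withPred (S.image φ)).card :=
      Nat.mul_le_mul_left _ (by omega)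
    refine le_trans ?_ h1
    omega

lemma isMinWeight_two_mul {j m t : ℕ} (hj : 1 ≤ j) (hm : 1 ≤ m) (hmp : m + 2 ≤ p)
    (ht : m * p ^ j + 1 ≤ t) (ht' : t ≤ (m + 1) * p ^ j) :
    IsMinWeight (cyclicPairWeight (A := F) (p ^ (j + 1))) (p ^ (j + 1)) t (2 * (m + 2)) := by
  have hq : 3 ≤ p ^ j := le_trans (by omega) (Nat.le_self_pow (by omega) p)
  refine ⟨fun f hf hd h => ?_, ?_⟩
  · rw [pow_succ] at hd ⊢
    exact two_mul_le_cyclicPairWeight hq hm hf hd ((pow_dvd_pow _ ht).trans h)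
  · obtain ⟨f, hf, hd, h, hw⟩ :=
      exists_word_of_mul (F := F) (p := p) (j := j) (m := m + 1) (by omega)
    exact ⟨f, hf, hd, (pow_dvd_pow _ ht').trans h, hw⟩

end ResidueClasses

/-! ### Assembling the cases -/

section Main

variable {F : Type*} [Field F] {p : ℕ} [Fact p.Prime] [CharP F p]

lemma minWeight_pairWeight_eq_of_repeat {k l K s w t : ℕ} (hk : k = l + K)
    {C : Ideal (CyclicRing (ChainRing F) (p ^ k))} (ht : IsTorsionalDegree 3 C t)
    (hw : IsMinWeight (cyclicPairWeight (A := F) (p ^ K)) (p ^ K) s w)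
    (hts : t = p ^ k - p ^ K + s) : minWeight pairWeight C = p ^ l * w := by
  have h := hw.repeat l
  rw [← pow_add, ← hk, ← hts] at h
  exact minWeight_pairWeight_eq ht h

end Main

end CyclicCode

end

theorem mainTheorem1 (p m k : ℕ) (hp : p.Prime) (hm : 1 ≤ m) (hk : 1 ≤ k)
    (F : Type*) [Field F] [Finite F] (hF : Nat.card F = p ^ m)
    (C : Ideal (CyclicCode.CyclicRing (CyclicCode.ChainRing F) (p ^ k))) :
    (∃! t₃ : ℕ, CyclicCode.IsTorsionalDegree 3 C t₃) ∧
    ∀ t₃ : ℕ, CyclicCode.IsTorsionalDegree 3 C t₃ →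
      ((t₃ = 0 → CyclicCode.minWeight CyclicCode.pairWeight C = 2) ∧
       (∀ l : ℕ, l + 2 ≤ k → t₃ = p ^ k - p ^ (k - l) + 1 →
          CyclicCode.minWeight CyclicCode.pairWeight C = 3 * p ^ l) ∧
       (∀ l : ℕ, l + 2 ≤ k →
          p ^ k - p ^ (k - l) + 2 ≤ t₃ → t₃ ≤ p ^ k - p ^ (k - l) + p ^ (k - l - 1) →
          CyclicCode.minWeight CyclicCode.pairWeight C = 4 * p ^ l) ∧
       (∀ l μ : ℕ, l + 2 ≤ k → 1 ≤ μ → μ + 2 ≤ p →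
          p ^ k - p ^ (k - l) + μ * p ^ (k - l - 1) + 1 ≤ t₃ →
          t₃ ≤ p ^ k - p ^ (k - l) + (μ + 1) * p ^ (k - l - 1) →
          CyclicCode.minWeight CyclicCode.pairWeight C = 2 * (μ + 2) * p ^ l) ∧
       (∀ μ : ℕ, 1 ≤ μ → μ + 2 ≤ p → t₃ = p ^ k - p + μ →
          CyclicCode.minWeight CyclicCode.pairWeight C = (μ + 2) * p ^ (k - 1)) ∧
       (t₃ = p ^ k - 1 → CyclicCode.minWeight CyclicCode.pairWeight C = p ^ k) ∧
       (t₃ = p ^ k → CyclicCode.minWeight CyclicCode.pairWeight C = 0)) ∧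
      ((t₃ < p ^ k → CyclicCode.minWeight CyclicCode.rtWeight C = t₃ + 1) ∧
       (t₃ = p ^ k → CyclicCode.minWeight CyclicCode.rtWeight C = 0)) := by
  have : Fact p.Prime := ⟨hp⟩
  have : Fintype F := Fintype.ofFinite F
  have : CharP F p := charP_of_card_eq_prime_pow (f := m) (by rw [← Nat.card_eq_fintype_card, hF])
  have hpk : p ≤ p ^ k := Nat.le_self_pow (by omega) p
  have h2 := hp.two_le
  have hprime : ∀ {s : ℕ}, s < p →
      CyclicCode.IsMinWeight (CyclicCode.cyclicPairWeight (A := F) (p ^ 1)) (p ^ 1) s (min (s + 2) p) := fun hs => by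
    rw [pow_one]
    exact CyclicCode.isMinWeight_prime hs
  refine ⟨CyclicCode.existsUnique_isTorsionalDegree 3 C, fun t ht => ⟨⟨?_, ?_, ?_, ?_, ?_, ?_, ?_⟩, ?_, ?_⟩⟩
  · rintro rfl
    exact CyclicCode.minWeight_pairWeight_eq ht (CyclicCode.isMinWeight_zero (by omega))
  · intro l hl hts
    have h3 : 3 ≤ p ^ (k - l) := by
      calc 3 ≤ 2 ^ 2 := by norm_num
        _ ≤ p ^ 2 := Nat.pow_le_pow_left h2 2
        _ ≤ _ := Nat.pow_le_pow_right hp.pos (by omega)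
    rw [mul_comm]
    exact CyclicCode.minWeight_pairWeight_eq_of_repeat (by omega) ht (CyclicCode.isMinWeight_one h3) hts
  · intro l hl hts hts'
    obtain ⟨j, rfl⟩ : ∃ j, k = l + (j + 1) := ⟨k - l - 1, by omega⟩
    simp only [Nat.add_sub_cancel_left, Nat.add_sub_cancel] at hts hts'
    rw [mul_comm]
    exact CyclicCode.minWeight_pairWeight_eq_of_repeat (s := t - (p ^ (l + (j + 1)) - p ^ (j + 1))) rfl ht
      (CyclicCode.isMinWeight_four (by omega) (by omega) (by omega)) (by omega)
  · intro l μ hl hμ hμp hts hts'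
    obtain ⟨j, rfl⟩ : ∃ j, k = l + (j + 1) := ⟨k - l - 1, by omega⟩
    simp only [Nat.add_sub_cancel_left, Nat.add_sub_cancel] at hts hts'
    rw [mul_comm]
    exact CyclicCode.minWeight_pairWeight_eq_of_repeat (s := t - (p ^ (l + (j + 1)) - p ^ (j + 1))) rfl ht
      (CyclicCode.isMinWeight_two_mul (by omega) hμ hμp (by omega) (by omega)) (by omega)
  · intro μ hμ hμp hts
    have h := CyclicCode.minWeight_pairWeight_eq_of_repeat (l := k - 1) (by omega) ht
      (hprime (s := μ) (by omega)) (by rw [pow_one, hts])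
    rw [h, min_eq_left hμp, mul_comm]
  · intro hts
    have h := CyclicCode.minWeight_pairWeight_eq_of_repeat (l := k - 1) (by omega) ht
      (hprime (s := p - 1) (by omega)) (by rw [pow_one]; omega)
    -- Here `s + 2 = p + 1` exceeds the length `p`, so the minimum is `p`.
    rw [h, min_eq_right (by omega), ← pow_succ, Nat.sub_add_cancel hk]
  · rintro rfl
    exact CyclicCode.minWeight_eq_zero ht _
  · exact fun hlt => CyclicCode.minWeight_rtWeight_eq ht (CyclicCode.isMinWeight_natDegree hlt)
  · rintro rfl
    exact CyclicCode.minWeight_eq_zero ht _
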